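/- Let $A>1$ and $q>0$. There is a constant $c>0$, depending only on $A$ and $q$, such that the following holds for all integers $d\ge 1$, $M\ge 2$ and $n$ with $\log M\le 16(\min(1,A-1))^2\,n$. Let $\mathcal F(A)$ be the set of probability densities on $\mathbb R^d$ (with respect to Lebesgue measure) bounded by $A$, let $\mathcal F_v(A)$ be the set of measurable functions $g:\mathbb R^d\to\mathbb R$ with $|g|\le A$, and let $v(f,g)=\int_{\mathbb R^d}|f(x)-g(x)|\,dx\in[0,\infty]$. Then $$\sup_{f_1,\dots,f_M\in\mathcal F_v(A)}\ \inf_{\hat f_n}\ \sup_{f\in\mathcal F(A)}\Big[\mathbb E_f\big[v(f,\hat f_n)^q\big]-\min_{j=1,\dots,M}v(f,f_j)^q\Big]\ \ge\ c\Big(\frac{\log M}{n}\Big)^{q/2}.$$ Here the infimum is over all estimators $\hat f_n$ based on $n$ observations $X_1,\dots,X_n$ in $\mathbb R^d$, that is, all functions $\hat f_n(x;X_1,\dots,X_n)$ with real values that are jointly measurable in $(x,X_1,\dots,X_n)$, and $\mathbb E_f$ is the expectation when $X_1,\dots,X_n$ are i.i.d. with density $f$. The bracket is read as $-\infty$ when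 the minimum in it is infinite. -/

import Mathlib

open MeasureTheory
open scoped ENNReal

noncomputable section

namespace Aggregation

variable {X : Type*} [MeasurableSpace X]

/-- The probability densities on `X` with respect to `ν` that are bounded by `A`. -/
def boundedDensities (ν : Measure X) (A : ℝ) : Set (X → ℝ) :=
  {f | Measurable f ∧ (∀ x, 0 ≤ f x) ∧ (∀ x, f x ≤ A) ∧ ∫⁻ x, ENNReal.ofReal (f x) ∂ν = 1}

/-- The measurable real functions on `X` that are bounded by `A` in absolute value. -/
def boundedFunctions (X : Type*) [MeasurableSpace X] (A : ℝ) : Set (X → ℝ) :=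
  {f | Measurable f ∧ ∀ x, |f x| ≤ A}

/-- The `L₁`-distance `v(f, g) = ∫ |f - g| dν`, with value `∞` if `f - g` is not integrable. -/
def l1Dist (ν : Measure X) (f g : X → ℝ) : ℝ≥0∞ :=
  ∫⁻ x, ENNReal.ofReal |f x - g x| ∂ν

/-- The law of `n` i.i.d. observations with density `f` with respect to `ν`. -/
def sampleLaw (ν : Measure X) (n : ℕ) (f : X → ℝ) : Measure (Fin n → X) :=
  Measure.pi fun _ => ν.withDensity fun x => ENNReal.ofReal (f x)

/-- The estimators based on a sample of size `n`: real functions on `X` that depend on the sample,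
measurable jointly in the sample and the point. No other restriction (sign, total mass,
integrability) is imposed on the values of an estimator. -/
def estimators (X : Type*) [MeasurableSpace X] (n : ℕ) : Set ((Fin n → X) → X → ℝ) :=
  {e | Measurable (Function.uncurry e)}

/-- The risk `E_f [v(f, e) ^ q]` of the estimator `e` when the true density is `f`. -/
def l1Risk (ν : Measure X) (n : ℕ) (q : ℝ) (f : X → ℝ) (e : (Fin n → X) → X → ℝ) : ℝ≥0∞ :=
  ∫⁻ s, l1Dist ν f (e s) ^ q ∂(sampleLaw ν n f)

/-- The excess risk `E_f [v(f, e) ^ q] - min_j v(f, g_j) ^ q`, as an extended real number. If the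
minimum is infinite, its value is `-∞`, even where the risk is infinite as well. -/
def l1ExcessRisk (ν : Measure X) {M : ℕ} (n : ℕ) (q : ℝ) (g : Fin M → X → ℝ)
    (e : (Fin n → X) → X → ℝ) (f : X → ℝ) : EReal :=
  (l1Risk ν n q f e : EReal) - ((⨅ j, l1Dist ν f (g j) ^ q : ℝ≥0∞) : EReal)

end Aggregation

end

/-! The aggregated functions are themselves chosen as densities `f j`, so at `f = f j` the minimum
vanishes and the excess risk is the plain risk. Estimation is then at least as hard as identifying
`j`.

Take `f j = 1 + δ r_j` on the unit cube, with `r_j` the Rademacher functions of one coordinate and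
`δ = √(log M / n) / 4`. The bound on `log M` says exactly that `δ ≤ min 1 (A - 1)`, which makes `f
j` a density bounded by `A`. Orthogonality of the signs makes all mutual distances equal to `δ`
(`l1Dist_perturbed`). The likelihood ratio to the uniform law has second moment `(1 + δ ^ 2) ^ n ≤
√M`, too small for a test to find `j` with average success above `7 / 8`
(`sum_sampleLaw_perturbed_le`). Hence for some `j` the error is at least `δ / 2` with probability at
least `1 / 8` (`exists_le_l1Risk`). -/

namespace Aggregation

/-! ### Densities of product measures -/

section ProductDensity

variable {X : Type*} [MeasurableSpace X]

lemma lintegral_pi_prod {n : ℕ} (μ : Measure X) [IsProbabilityMeasure μ]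
    (f : Fin n → X → ℝ≥0∞) (hf : ∀ i, Measurable (f i)) :
    ∫⁻ s, ∏ i, f i (s i) ∂(Measure.pi fun _ : Fin n => μ) = ∏ i, ∫⁻ x, f i x ∂μ := by
  have hind : ProbabilityTheory.iIndepFun (fun i (s : Fin n → X) => f i (s i))
      (Measure.pi fun _ : Fin n => μ) :=
    ProbabilityTheory.iIndepFun_pi (X := f) fun i => (hf i).aemeasurable
  have key := ProbabilityTheory.lintegral_prod_eq_prod_lintegral_of_indepFun Finset.univ
    (fun i (s : Fin n → X) => f i (s i)) hind fun i => (hf i).comp (measurable_pi_apply i)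
  rw [key]
  exact Finset.prod_congr rfl fun i _ =>
    (measurePreserving_eval (fun _ : Fin n => μ) i).lintegral_comp (hf i)

lemma pi_withDensity {n : ℕ} (μ : Measure X) [IsProbabilityMeasure μ]
    (h : X → ℝ≥0∞) (hh : Measurable h) [SigmaFinite (μ.withDensity h)] :
    (Measure.pi fun _ : Fin n => μ.withDensity h) =
      (Measure.pi fun _ : Fin n => μ).withDensity fun s => ∏ i, h (s i) := by
  refine Measure.pi_eq fun s hs => ?_
  rw [withDensity_apply _ (MeasurableSet.univ_pi hs),
    ← lintegral_indicator (MeasurableSet.univ_pi hs)]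
  have : ∀ x : Fin n → X, (Set.univ.pi s).indicator (fun s => ∏ i, h (s i)) x =
      ∏ i, (s i).indicator h (x i) := by
    intro x
    by_cases hx : x ∈ Set.univ.pi s
    · rw [Set.indicator_of_mem hx]
      exact Finset.prod_congr rfl fun i _ => (Set.indicator_of_mem (hx i trivial) h).symm
    · rw [Set.indicator_of_notMem hx]
      simp only [Set.mem_univ_pi, not_forall] at hx
      obtain ⟨i, hi⟩ := hx
      exact (Finset.prod_eq_zero (Finset.mem_univ i) (Set.indicator_of_notMem hi h)).symm
  simp_rw [this]
  rw [lintegral_pi_prod μ _ fun i => hh.indicator (hs i)]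
  exact Finset.prod_congr rfl fun i _ => by
    rw [lintegral_indicator (hs i), withDensity_apply _ (hs i)]

end ProductDensity

/-! ### Reduction from estimation to testing -/

section Reduction

variable {X : Type*} [MeasurableSpace X]

lemma l1Dist_triangle {ν : Measure X} {f g h : X → ℝ} (hf : Measurable f) (hh : Measurable h) :
    l1Dist ν f g ≤ l1Dist ν f h + l1Dist ν g h := by
  unfold l1Dist
  rw [← lintegral_add_left (by fun_prop)]
  refine lintegral_mono fun x => ?_
  rw [← ENNReal.ofReal_add (abs_nonneg _) (abs_nonneg _)]
  refine ENNReal.ofReal_le_ofReal ?_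
  rw [abs_sub_comm (g x)]
  exact abs_sub_le _ _ _

/-- A family of separated functions, whose sample laws cannot be told apart with average
success probability above `7 / 8`, forces a large risk at one of its members. -/
lemma exists_le_l1Risk {ν : Measure X} [SigmaFinite ν] {M n : ℕ} (hM : 0 < M) {q ρ : ℝ}
    (hq : 0 < q) (hρ : 0 < ρ) (f : Fin M → X → ℝ) (hf : ∀ j, Measurable (f j))
    (hprob : ∀ j, IsProbabilityMeasure (sampleLaw ν n (f j)))
    (hsep : ∀ j k, j ≠ k → ENNReal.ofReal (2 * ρ) ≤ l1Dist ν (f j) (f k))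
    (htest : ∀ B : Fin M → Set (Fin n → X), (∀ j, MeasurableSet (B j)) →
      Pairwise (Function.onFun Disjoint B) →
      ∑ j, sampleLaw ν n (f j) (B j) ≤ ENNReal.ofReal (7 / 8 * M))
    {e : (Fin n → X) → X → ℝ} (he : e ∈ estimators X n) :
    ∃ j, ENNReal.ofReal (ρ ^ q / 8) ≤ l1Risk ν n q (f j) e := by
  by_contra! hcon
  have he' : Measurable (Function.uncurry e) := he
  have hmeas : ∀ j, Measurable fun s => l1Dist ν (f j) (e s) := by
    intro j
    have h2 : Measurable fun p : (Fin n → X) × X => ENNReal.ofReal |f j p.2 - e p.1 p.2| :=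
      ENNReal.measurable_ofReal.comp
        (continuous_abs.measurable.comp (((hf j).comp measurable_snd).sub he'))
    exact h2.lintegral_prod_right'
  -- The test accepts `j` when the estimate lies within `ρ` of `f j`; separation by `2 * ρ` makes
  -- these events disjoint.
  let B : Fin M → Set (Fin n → X) := fun j => {s | l1Dist ν (f j) (e s) < ENNReal.ofReal ρ}
  have hB : ∀ j, MeasurableSet (B j) := fun j => measurableSet_lt (hmeas j) measurable_const
  have hdisj : Pairwise (Function.onFun Disjoint B) := by
    intro j k hjk
    refine Set.disjoint_left.2 fun s hj hk => ?_
    have hes : Measurable (e s) := he'.comp measurable_prodMk_left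
    have h1 := (hsep j k hjk).trans (l1Dist_triangle (hf j) hes)
    have h2 := h1.trans_lt (ENNReal.add_lt_add hj hk)
    rw [← ENNReal.ofReal_add hρ.le hρ.le, two_mul] at h2
    exact lt_irrefl _ h2
  have hρq : 0 < ρ ^ q := Real.rpow_pos_of_pos hρ q
  -- Markov's inequality: a risk below `ρ ^ q / 8` leaves probability below `1 / 8` outside `B j`.
  have hlarge : ∀ j, ENNReal.ofReal (7 / 8) < sampleLaw ν n (f j) (B j) := by
    intro j
    have := hprob j
    have hmk := mul_meas_ge_le_lintegral (μ := sampleLaw ν n (f j))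
      ((hmeas j).pow_const q) (ENNReal.ofReal (ρ ^ q))
    have hset : {s | ENNReal.ofReal (ρ ^ q) ≤ l1Dist ν (f j) (e s) ^ q} = (B j)ᶜ := by
      ext s
      rw [Set.mem_ofPred_eq, ← ENNReal.ofReal_rpow_of_pos hρ, ENNReal.rpow_le_rpow_iff hq]
      simp [B]
    rw [hset] at hmk
    have h1 := hmk.trans_lt (hcon j)
    have h2 : sampleLaw ν n (f j) (B j)ᶜ < ENNReal.ofReal (1 / 8) := by
      rw [div_eq_mul_one_div, ENNReal.ofReal_mul hρq.le] at h1
      exact lt_of_mul_lt_mul_left' h1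
    by_contra! h3
    have h5 : sampleLaw ν n (f j) (B j) + sampleLaw ν n (f j) (B j)ᶜ <
        ENNReal.ofReal (7 / 8) + ENNReal.ofReal (1 / 8) :=
      ENNReal.add_lt_add_of_le_of_lt (measure_ne_top _ _) h3 h2
    rw [measure_add_measure_compl (hB j), measure_univ,
      ← ENNReal.ofReal_add (by norm_num) (by norm_num)] at h5
    norm_num at h5
  have hsum : ∑ _j : Fin M, ENNReal.ofReal (7 / 8) < ∑ j, sampleLaw ν n (f j) (B j) :=
    ENNReal.sum_lt_sum_of_nonempty ⟨⟨0, hM⟩, Finset.mem_univ _⟩ fun j _ => hlarge j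
  refine absurd (htest B hB hdisj) (not_le.2 (lt_of_eq_of_lt ?_ hsum))
  rw [Finset.sum_const, Finset.card_univ, Fintype.card_fin, nsmul_eq_mul, mul_comm,
    ENNReal.ofReal_mul (by norm_num), ENNReal.ofReal_natCast]

end Reduction

/-! ### Sign perturbations of the uniform density -/

section Perturbation

variable {X : Type*} [MeasurableSpace X]

/-- The perturbation `1 + δ r` of the uniform density on `Q`. -/
noncomputable def perturbed (Q : Set X) (δ : ℝ) (r : X → ℝ) : X → ℝ :=
  Q.indicator fun x => 1 + δ * r x

lemma measurable_perturbed {Q : Set X} (hQ : MeasurableSet Q) {δ : ℝ} {r : X → ℝ}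
    (hr : Measurable r) : Measurable (perturbed Q δ r) :=
  Measurable.indicator (by fun_prop) hQ

lemma integrable_of_abs_eq_one {μ : Measure X} [IsFiniteMeasure μ] {r : X → ℝ}
    (hr : Measurable r) (h1 : ∀ x, |r x| = 1) : Integrable r μ :=
  Integrable.of_bound hr.aestronglyMeasurable 1 (.of_forall fun x => (h1 x).le)

lemma one_add_mul_nonneg {δ y : ℝ} (hδ : 0 ≤ δ) (hδ1 : δ ≤ 1) (hy : |y| = 1) : 0 ≤ 1 + δ * y := by
  rcases (abs_eq zero_le_one).1 hy with h | h <;> rw [h] <;> linarith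

lemma withDensity_perturbed {ν : Measure X} {Q : Set X} (hQ : MeasurableSet Q) {δ : ℝ}
    {r : X → ℝ} :
    ν.withDensity (fun x => ENNReal.ofReal (perturbed Q δ r x)) =
      (ν.restrict Q).withDensity fun x => ENNReal.ofReal (1 + δ * r x) := by
  rw [← withDensity_indicator hQ]
  congr 1
  ext x
  by_cases hx : x ∈ Q <;> simp [perturbed, hx]

lemma lintegral_one_add_mul {μ : Measure X} [IsProbabilityMeasure μ] {δ : ℝ} (hδ : 0 ≤ δ)
    (hδ1 : δ ≤ 1) {r : X → ℝ} (hr : Measurable r) (h1 : ∀ x, |r x| = 1)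
    (h0 : ∫ x, r x ∂μ = 0) : ∫⁻ x, ENNReal.ofReal (1 + δ * r x) ∂μ = 1 := by
  have hi := integrable_of_abs_eq_one (μ := μ) hr h1
  have hi1 : Integrable (fun x => 1 + δ * r x) μ := (integrable_const _).add (hi.const_mul δ)
  rw [← ofReal_integral_eq_lintegral_ofReal hi1 (.of_forall fun x => one_add_mul_nonneg hδ hδ1 (h1 x)),
    integral_add (integrable_const _) (hi.const_mul δ), integral_const_mul, h0]
  simp

lemma lintegral_sq_one_add_mul {μ : Measure X} [IsProbabilityMeasure μ] {δ : ℝ}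
    {r : X → ℝ} (hr : Measurable r) (h1 : ∀ x, |r x| = 1)
    (h0 : ∫ x, r x ∂μ = 0) :
    ∫⁻ x, ENNReal.ofReal ((1 + δ * r x) ^ 2) ∂μ = ENNReal.ofReal (1 + δ ^ 2) := by
  have hi := integrable_of_abs_eq_one (μ := μ) hr h1
  have he : ∀ x, (1 + δ * r x) ^ 2 = (1 + δ ^ 2) + 2 * δ * r x := by
    intro x
    have : r x ^ 2 = 1 := by rw [← sq_abs, h1, one_pow]
    linear_combination δ ^ 2 * this
  rw [← ofReal_integral_eq_lintegral_ofReal _ (.of_forall fun x => sq_nonneg _)]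
  · simp_rw [he]
    rw [integral_add (integrable_const _) (hi.const_mul _), integral_const_mul, h0]
    simp
  · simp_rw [he]
    exact (integrable_const _).add (hi.const_mul _)

lemma perturbed_mem_boundedDensities {ν : Measure X} {Q : Set X} (hQ : MeasurableSet Q)
    [IsProbabilityMeasure (ν.restrict Q)] {A δ : ℝ} (hδ : 0 ≤ δ) (hδ1 : δ ≤ 1) (hδA : 1 + δ ≤ A)
    {r : X → ℝ} (hr : Measurable r) (h1 : ∀ x, |r x| = 1) (h0 : ∫ x in Q, r x ∂ν = 0) :
    perturbed Q δ r ∈ boundedDensities ν A := by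
  refine ⟨measurable_perturbed hQ hr, fun x => ?_, fun x => ?_, ?_⟩
  · exact Set.indicator_nonneg (fun x _ => one_add_mul_nonneg hδ hδ1 (h1 x)) x
  · refine Set.indicator_apply_le' (fun _ => ?_) fun _ => by linarith
    have := mul_le_mul_of_nonneg_left ((le_abs_self (r x)).trans (h1 x).le) hδ
    linarith
  · have := withDensity_apply (μ := ν) (fun x => ENNReal.ofReal (perturbed Q δ r x))
      MeasurableSet.univ
    rw [Measure.restrict_univ] at this
    rw [← this, withDensity_perturbed hQ, withDensity_apply _ .univ, Measure.restrict_univ,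
      lintegral_one_add_mul hδ hδ1 hr h1 h0]

lemma isProbabilityMeasure_withDensity_perturbed {ν : Measure X} {Q : Set X}
    (hQ : MeasurableSet Q) [IsProbabilityMeasure (ν.restrict Q)] {δ : ℝ} (hδ : 0 ≤ δ)
    (hδ1 : δ ≤ 1) {r : X → ℝ} (hr : Measurable r) (h1 : ∀ x, |r x| = 1)
    (h0 : ∫ x in Q, r x ∂ν = 0) :
    IsProbabilityMeasure (ν.withDensity fun x => ENNReal.ofReal (perturbed Q δ r x)) := by
  rw [withDensity_perturbed hQ]
  exact ⟨by rw [withDensity_apply _ .univ, Measure.restrict_univ,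
    lintegral_one_add_mul hδ hδ1 hr h1 h0]⟩

lemma sampleLaw_perturbed {ν : Measure X} {Q : Set X} (hQ : MeasurableSet Q)
    [IsProbabilityMeasure (ν.restrict Q)] {δ : ℝ} (hδ : 0 ≤ δ) (hδ1 : δ ≤ 1)
    {r : X → ℝ} (hr : Measurable r) (h1 : ∀ x, |r x| = 1) (h0 : ∫ x in Q, r x ∂ν = 0) (n : ℕ) :
    sampleLaw ν n (perturbed Q δ r) = (Measure.pi fun _ : Fin n => ν.restrict Q).withDensity
      fun s => ENNReal.ofReal (∏ i, (1 + δ * r (s i))) := by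
  have := isProbabilityMeasure_withDensity_perturbed hQ hδ hδ1 hr h1 h0
  unfold sampleLaw
  rw [withDensity_perturbed hQ] at this ⊢
  rw [pi_withDensity _ _ (by fun_prop)]
  congr 1
  ext s
  rw [ENNReal.ofReal_prod_of_nonneg fun i _ => one_add_mul_nonneg hδ hδ1 (h1 _)]

/-- For signs, `|r - r'| = 1 - r * r'`, and the product integrates to zero. -/
lemma l1Dist_perturbed {ν : Measure X} {Q : Set X} (hQ : MeasurableSet Q)
    [IsProbabilityMeasure (ν.restrict Q)] {δ : ℝ} (hδ : 0 ≤ δ) {r r' : X → ℝ}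
    (hr : Measurable r) (hr' : Measurable r') (h1 : ∀ x, |r x| = 1) (h1' : ∀ x, |r' x| = 1)
    (hrr' : ∫ x in Q, r x * r' x ∂ν = 0) :
    l1Dist ν (perturbed Q δ r) (perturbed Q δ r') = ENNReal.ofReal δ := by
  have hi : Integrable (fun x => r x * r' x) (ν.restrict Q) :=
    integrable_of_abs_eq_one (hr.mul hr') fun x => by rw [abs_mul, h1, h1', one_mul]
  have he : ∀ x, ENNReal.ofReal |perturbed Q δ r x - perturbed Q δ r' x| =
      Q.indicator (fun x => ENNReal.ofReal (δ * (1 - r x * r' x))) x := by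
    intro x
    by_cases hx : x ∈ Q
    · simp only [perturbed, Set.indicator_of_mem hx]
      congr 1
      rw [add_sub_add_left_eq_sub, ← mul_sub, abs_mul, abs_of_nonneg hδ]
      congr 1
      rcases (abs_eq zero_le_one).1 (h1 x) with h | h <;>
        rcases (abs_eq zero_le_one).1 (h1' x) with h' | h' <;> rw [h, h'] <;> norm_num
    · simp [perturbed, hx]
  unfold l1Dist
  simp_rw [he]
  have hi1 : Integrable (fun x => δ * (1 - r x * r' x)) (ν.restrict Q) :=
    ((integrable_const _).sub hi).const_mul δ
  rw [lintegral_indicator hQ, ← ofReal_integral_eq_lintegral_ofReal hi1]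
  · rw [integral_const_mul, integral_sub (integrable_const _) hi, hrr']
    simp
  · refine .of_forall fun x => mul_nonneg hδ ?_
    have := le_abs_self (r x * r' x)
    rw [abs_mul, h1, h1', one_mul] at this
    exact sub_nonneg.2 this

/-- Second moment bound for the success probabilities of a test between `M` perturbations. -/
lemma sum_sampleLaw_perturbed_le {ν : Measure X} {Q : Set X} (hQ : MeasurableSet Q)
    [IsProbabilityMeasure (ν.restrict Q)] {δ : ℝ} (hδ : 0 ≤ δ) (hδ1 : δ ≤ 1) {M n : ℕ}
    (r : Fin M → X → ℝ) (hr : ∀ j, Measurable (r j)) (h1 : ∀ j x, |r j x| = 1)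
    (h0 : ∀ j, ∫ x in Q, r j x ∂ν = 0) {t : ℝ} (ht : 0 < t) (B : Fin M → Set (Fin n → X))
    (hB : ∀ j, MeasurableSet (B j)) (hdisj : Pairwise (Function.onFun Disjoint B)) :
    ∑ j, sampleLaw ν n (perturbed Q δ (r j)) (B j) ≤
      ENNReal.ofReal (t / 2 + M * ((1 + δ ^ 2) ^ n / (2 * t))) := by
  set P : Measure (Fin n → X) := Measure.pi fun _ : Fin n => ν.restrict Q with hP
  have hone : ∀ j, sampleLaw ν n (perturbed Q δ (r j)) (B j) ≤
      ENNReal.ofReal (t / 2) * P (B j) + ENNReal.ofReal ((1 + δ ^ 2) ^ n / (2 * t)) := by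
    intro j
    rw [sampleLaw_perturbed hQ hδ hδ1 (hr j) (h1 j) (h0 j), withDensity_apply _ (hB j), ← hP]
    -- For the likelihood ratio `l`, `l ≤ t / 2 + l ^ 2 / (2 * t)`. The constant part is summed
    -- using disjointness of the `B j`, the quadratic part is bounded by the full second moment.
    have hpt : ∀ s : Fin n → X, ENNReal.ofReal (∏ i, (1 + δ * r j (s i))) ≤
        ENNReal.ofReal (t / 2) +
          ENNReal.ofReal (1 / (2 * t)) * ∏ i, ENNReal.ofReal ((1 + δ * r j (s i)) ^ 2) := by
      intro s
      rw [← ENNReal.ofReal_prod_of_nonneg fun i _ => sq_nonneg _, Finset.prod_pow,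
        ← ENNReal.ofReal_mul (by positivity), ← ENNReal.ofReal_add (by positivity) (by positivity)]
      refine ENNReal.ofReal_le_ofReal ?_
      generalize ∏ i, (1 + δ * r j (s i)) = l
      have : t / 2 + 1 / (2 * t) * l ^ 2 - l = (t - l) ^ 2 / (2 * t) := by
        field_simp
        ring
      have h2 : 0 ≤ (t - l) ^ 2 / (2 * t) := by positivity
      linarith
    have hm : ∀ _ : Fin n, Measurable fun x => ENNReal.ofReal ((1 + δ * r j x) ^ 2) := by
      have := hr j
      intro _
      fun_prop
    calc ∫⁻ s in B j, ENNReal.ofReal (∏ i, (1 + δ * r j (s i))) ∂P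
        ≤ ∫⁻ s in B j, (ENNReal.ofReal (t / 2) +
          ENNReal.ofReal (1 / (2 * t)) * ∏ i, ENNReal.ofReal ((1 + δ * r j (s i)) ^ 2)) ∂P :=
          lintegral_mono hpt
      _ = ENNReal.ofReal (t / 2) * P (B j) + ∫⁻ s in B j,
          ENNReal.ofReal (1 / (2 * t)) * ∏ i, ENNReal.ofReal ((1 + δ * r j (s i)) ^ 2) ∂P := by
          rw [lintegral_add_left measurable_const, setLIntegral_const]
      _ ≤ ENNReal.ofReal (t / 2) * P (B j) + ∫⁻ s,
          ENNReal.ofReal (1 / (2 * t)) * ∏ i, ENNReal.ofReal ((1 + δ * r j (s i)) ^ 2) ∂P := by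
          gcongr
          exact Measure.restrict_le_self
      _ = _ := by
          rw [lintegral_const_mul' _ _ ENNReal.ofReal_ne_top, hP, lintegral_pi_prod _ _ hm,
            Finset.prod_const, lintegral_sq_one_add_mul (hr j) (h1 j) (h0 j), Finset.card_univ,
            Fintype.card_fin, ← ENNReal.ofReal_pow (by positivity),
            ← ENNReal.ofReal_mul (by positivity), one_div_mul_eq_div]
  refine (Finset.sum_le_sum fun j _ => hone j).trans ?_
  rw [Finset.sum_add_distrib, ← Finset.mul_sum, Finset.sum_const, Finset.card_univ,
    Fintype.card_fin, nsmul_eq_mul, ENNReal.ofReal_add (by positivity) (by positivity),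
    ENNReal.ofReal_mul (by positivity), ENNReal.ofReal_natCast]
  gcongr
  have hsum : ∑ j, P (B j) = P (⋃ j, B j) := by
    rw [measure_iUnion hdisj hB, tsum_fintype]
  rw [hsum]
  exact (mul_le_mul_right prob_le_one _).trans_eq (mul_one _)

end Perturbation

/-! ### Rademacher functions and their orthogonality -/

section Rademacher

/-- The Rademacher functions on the real line. -/
noncomputable def rademacher (k : ℕ) (x : ℝ) : ℝ := if Even ⌊2 ^ (k + 1) * x⌋ then 1 else -1

lemma abs_rademacher (k : ℕ) (x : ℝ) : |rademacher k x| = 1 := by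
  unfold rademacher
  split_ifs <;> simp

lemma measurable_rademacher (k : ℕ) : Measurable (rademacher k) :=
  (Measurable.of_discrete (f := fun m : ℤ => if Even m then (1 : ℝ) else -1)).comp
    (Int.measurable_floor.comp (measurable_const_mul _))

lemma rademacher_add_of_even {k : ℕ} {T : ℝ} {m : ℤ} (hT : 2 ^ (k + 1) * T = m) (hm : Even m)
    (x : ℝ) : rademacher k (x + T) = rademacher k x := by
  unfold rademacher
  rw [mul_add, hT, Int.floor_add_intCast]
  simp [Int.even_add, hm]

lemma rademacher_antiperiodic (k : ℕ) : Function.Antiperiodic (rademacher k) (1 / 2 ^ (k + 1)) := by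
  intro x
  unfold rademacher
  rw [mul_add, mul_one_div_cancel (by positivity), Int.floor_add_one]
  by_cases h : Even ⌊2 ^ (k + 1) * x⌋ <;> simp [h]

lemma rademacher_periodic_one (k : ℕ) : Function.Periodic (rademacher k) 1 :=
  rademacher_add_of_even (m := 2 ^ (k + 1)) (by push_cast; ring) (by simp [Int.even_pow])

lemma rademacher_periodic_of_lt {j k : ℕ} (h : j < k) :
    Function.Periodic (rademacher k) (1 / 2 ^ (j + 1)) := by
  obtain ⟨m, rfl⟩ := Nat.exists_eq_add_of_lt h
  refine rademacher_add_of_even (m := 2 ^ (m + 1)) ?_ (by simp [Int.even_pow])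
  push_cast
  field_simp
  ring

/-- Translation by `T` preserves the integral over a full period, yet changes its sign. -/
lemma setIntegral_Ioc_eq_zero {g : ℝ → ℝ} {T : ℝ} (hg : Function.Periodic g 1)
    (hT : Function.Antiperiodic g T) : ∫ x in Set.Ioc (0 : ℝ) 1, g x = 0 := by
  rw [← intervalIntegral.integral_of_le zero_le_one]
  have h1 : ∫ x in (0 : ℝ)..1, g (x + T) = ∫ x in (0 : ℝ)..1, g x := by
    rw [intervalIntegral.integral_comp_add_right, zero_add, add_comm (1 : ℝ),
      hg.intervalIntegral_add_eq T 0, zero_add]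
  simp_rw [hT _] at h1
  rw [intervalIntegral.integral_neg] at h1
  linarith

lemma integral_rademacher (k : ℕ) : ∫ x in Set.Ioc (0 : ℝ) 1, rademacher k x = 0 :=
  setIntegral_Ioc_eq_zero (rademacher_periodic_one k) (rademacher_antiperiodic k)

lemma integral_rademacher_mul {j k : ℕ} (h : j ≠ k) :
    ∫ x in Set.Ioc (0 : ℝ) 1, rademacher j x * rademacher k x = 0 := by
  wlog hjk : j < k generalizing j k
  · simp_rw [mul_comm (rademacher j _)]
    exact this h.symm (lt_of_le_of_ne (not_lt.1 hjk) h.symm)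
  -- Half a period of the coarser function is a whole number of periods of the finer one, so the
  -- product is antiperiodic.
  refine setIntegral_Ioc_eq_zero (T := 1 / 2 ^ (j + 1))
    ((rademacher_periodic_one j).mul (rademacher_periodic_one k)) fun x => ?_
  rw [rademacher_antiperiodic j x, rademacher_periodic_of_lt hjk x, neg_mul]

end Rademacher

/-! ### The unit cube and the lower bound -/

section Cube

/-- The half-open unit cube. -/
def unitCube (d : ℕ) : Set (Fin d → ℝ) := Set.univ.pi fun _ => Set.Ioc 0 1

lemma measurableSet_unitCube (d : ℕ) : MeasurableSet (unitCube d) :=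
  MeasurableSet.univ_pi fun _ => measurableSet_Ioc

instance : IsProbabilityMeasure (volume.restrict (Set.Ioc (0 : ℝ) 1)) :=
  ⟨by simp⟩

lemma restrict_unitCube (d : ℕ) : (volume : Measure (Fin d → ℝ)).restrict (unitCube d) =
    Measure.pi fun _ => volume.restrict (Set.Ioc (0 : ℝ) 1) :=
  Measure.restrict_pi_pi _ _

instance (d : ℕ) : IsProbabilityMeasure ((volume : Measure (Fin d → ℝ)).restrict (unitCube d)) := by
  rw [restrict_unitCube]
  infer_instance

lemma setIntegral_unitCube_eval {d : ℕ} (i : Fin d) {g : ℝ → ℝ} (hg : Measurable g) :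
    ∫ x in unitCube d, g (x i) = ∫ y in Set.Ioc (0 : ℝ) 1, g y := by
  rw [restrict_unitCube, integral_comp_eval hg.aestronglyMeasurable]

end Cube

/-- By `1 + x ≤ exp x` the power is at most `√M`, and `√M ≤ 3 / 4 * M` once `M ≥ 16 / 9`. -/
lemma one_add_sq_pow_le {M n : ℕ} (hM : 2 ≤ M) (hn : 0 < n) {δ : ℝ}
    (hδ : δ ^ 2 = Real.log M / (16 * n)) : (1 + δ ^ 2) ^ n ≤ 3 / 4 * (M : ℝ) := by
  have hM' : (2 : ℝ) ≤ M := by exact_mod_cast hM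
  have hlog : 0 ≤ Real.log M := Real.log_nonneg (by linarith)
  have hn' : (0 : ℝ) < n := by exact_mod_cast hn
  have h1 : (1 + δ ^ 2) ^ n ≤ Real.exp (Real.log M / 2) := by
    calc (1 + δ ^ 2) ^ n ≤ Real.exp (δ ^ 2) ^ n := by
          gcongr
          rw [add_comm]
          exact Real.add_one_le_exp _
      _ = Real.exp (n * δ ^ 2) := (Real.exp_nat_mul _ _).symm
      _ ≤ _ := by
          refine Real.exp_le_exp.2 ?_
          rw [hδ, mul_div_assoc', mul_comm (16 : ℝ), mul_div_mul_left _ _ hn'.ne']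
          linarith
  have h2 : Real.exp (Real.log M / 2) ^ 2 = M := by
    rw [← Real.exp_nat_mul, Nat.cast_ofNat, mul_div_cancel₀ _ two_ne_zero,
      Real.exp_log (by linarith)]
  have h3 := Real.exp_pos (Real.log M / 2)
  nlinarith

lemma le_l1ExcessRisk {X : Type*} [MeasurableSpace X] {ν : Measure X} {M n : ℕ} {q a : ℝ}
    (hq : 0 < q) (ha : 0 ≤ a) (g : Fin M → X → ℝ) (e : (Fin n → X) → X → ℝ) (j : Fin M)
    (h : ENNReal.ofReal a ≤ l1Risk ν n q (g j) e) :
    (a : EReal) ≤ l1ExcessRisk ν n q g e (g j) := by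
  have h0 : (⨅ k, l1Dist ν (g j) (g k) ^ q : ℝ≥0∞) = 0 := by
    refine le_antisymm ((iInf_le _ j).trans_eq ?_) zero_le
    simp [l1Dist, hq]
  unfold l1ExcessRisk
  rw [h0, EReal.coe_ennreal_zero, sub_zero]
  calc (a : EReal) = (ENNReal.ofReal a : EReal) := by
        rw [EReal.coe_ennreal_ofReal, max_eq_left ha]
    _ ≤ _ := EReal.coe_ennreal_le_coe_ennreal_iff.2 h

end Aggregation

open Aggregation in
theorem mainTheorem4 (A q : ℝ) (hA : 1 < A) (hq : 0 < q) :
    ∃ c : ℝ, 0 < c ∧ ∀ d M n : ℕ, 1 ≤ d → 2 ≤ M →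
      Real.log (M : ℝ) ≤ 16 * (min 1 (A - 1)) ^ 2 * (n : ℝ) →
      ((c * (Real.log (M : ℝ) / (n : ℝ)) ^ (q / 2) : ℝ) : EReal) ≤
        ⨆ g ∈ {g : Fin M → (Fin d → ℝ) → ℝ |
            ∀ j, g j ∈ Aggregation.boundedFunctions (Fin d → ℝ) A},
          ⨅ e ∈ Aggregation.estimators (Fin d → ℝ) n,
            ⨆ f ∈ Aggregation.boundedDensities (volume : Measure (Fin d → ℝ)) A,
              Aggregation.l1ExcessRisk (volume : Measure (Fin d → ℝ)) n q g e f := by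
  -- The base `1 / 8` comes from `δ / 2 = √u / 8`, the final factor `1 / 8` from the failure
  -- probability of the test.
  refine ⟨(1 / 8) ^ q / 8, by positivity, fun d M n hd hM hlog => ?_⟩
  have hM' : (2 : ℝ) ≤ M := by exact_mod_cast hM
  have hlogpos : 0 < Real.log M := Real.log_pos (by linarith)
  have hn : 0 < n := by
    rcases Nat.eq_zero_or_pos n with rfl | h
    · simp only [Nat.cast_zero, mul_zero] at hlog
      linarith
    · exact h
  have hn' : (0 : ℝ) < n := by exact_mod_cast hn
  set u : ℝ := Real.log M / n with hu
  have hupos : 0 < u := div_pos hlogpos hn'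
  set δ : ℝ := √u / 4 with hδdef
  have hδpos : 0 < δ := by positivity
  have hδsq : δ ^ 2 = Real.log M / (16 * n) := by
    rw [hδdef, div_pow, Real.sq_sqrt hupos.le, hu]
    field_simp
    norm_num
  have hmin : 0 ≤ min 1 (A - 1) := le_min zero_le_one (by linarith)
  have hδmin : δ ≤ min 1 (A - 1) := by
    refine le_of_sq_le_sq ?_ hmin
    rw [hδsq, div_le_iff₀ (by positivity)]
    linarith
  have hδ1 : δ ≤ 1 := hδmin.trans (min_le_left _ _)
  have hδA : 1 + δ ≤ A := by linarith [hδmin.trans (min_le_right _ _)]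
  let i0 : Fin d := ⟨0, hd⟩
  let r : Fin M → (Fin d → ℝ) → ℝ := fun j x => rademacher j (x i0)
  have hr : ∀ j, Measurable (r j) := fun j =>
    (measurable_rademacher j).comp (measurable_pi_apply i0)
  have h1 : ∀ j x, |r j x| = 1 := fun j x => abs_rademacher _ _
  have h0 : ∀ j, ∫ x in unitCube d, r j x = 0 := fun j =>
    (setIntegral_unitCube_eval i0 (measurable_rademacher j)).trans (integral_rademacher j)
  have horth : ∀ j k, j ≠ k → ∫ x in unitCube d, r j x * r k x = 0 := fun j k hjk =>
    (setIntegral_unitCube_eval i0 ((measurable_rademacher j).mul (measurable_rademacher k))).trans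
      (integral_rademacher_mul (Fin.val_injective.ne hjk))
  have hQ := measurableSet_unitCube d
  let f : Fin M → (Fin d → ℝ) → ℝ := fun j => perturbed (unitCube d) δ (r j)
  have hfdens : ∀ j, f j ∈ boundedDensities volume A := fun j =>
    perturbed_mem_boundedDensities hQ hδpos.le hδ1 hδA (hr j) (h1 j) (h0 j)
  refine le_iSup₂_of_le f (fun j => ⟨(hfdens j).1, fun x => ?_⟩) (le_iInf₂ fun e he => ?_)
  · rw [abs_of_nonneg ((hfdens j).2.1 x)]
    exact (hfdens j).2.2.1 x
  obtain ⟨j, hj⟩ := exists_le_l1Risk (ν := volume) (q := q) (ρ := δ / 2) (by omega) hq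
    (by positivity) f (fun j => (hfdens j).1)
    (fun j => by
      have := isProbabilityMeasure_withDensity_perturbed hQ hδpos.le hδ1 (hr j) (h1 j) (h0 j)
      unfold sampleLaw
      infer_instance)
    (fun j k hjk => by
      rw [mul_div_cancel₀ _ two_ne_zero]
      exact (l1Dist_perturbed hQ hδpos.le (hr j) (hr k) (h1 j) (h1 k) (horth j k hjk)).ge)
    (fun B hB hdisj => by
      -- With this `t` the bound is at most `(7 / 16 + 3 / 7) * M`, just under `7 / 8 * M`.
      refine (sum_sampleLaw_perturbed_le hQ hδpos.le hδ1 r hr h1 h0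
        (t := 7 / 8 * M) (by positivity) B hB hdisj).trans (ENNReal.ofReal_le_ofReal ?_)
      have hpow := one_add_sq_pow_le hM hn hδsq
      have : (M : ℝ) * ((1 + δ ^ 2) ^ n / (2 * (7 / 8 * M))) = 4 / 7 * (1 + δ ^ 2) ^ n := by
        field_simp
        norm_num
      rw [this]
      linarith) he
  refine le_iSup₂_of_le (f j) (hfdens j) (le_l1ExcessRisk hq (by positivity) f e j ?_)
  convert hj using 2
  rw [show δ / 2 = 1 / 8 * √u by rw [hδdef]; ring, Real.mul_rpow (by norm_num) (Real.sqrt_nonneg _),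
    Real.sqrt_eq_rpow, ← Real.rpow_mul hupos.le, one_div_mul_eq_div]
  ring
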